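/- Let $X$ be an alphabet and let $u,v\in X^+$ be such that $\langle X\mid u=v\rangle$ is an Adian (cycle-free) presentation: its left graph (vertex set $X$, one edge joining the first letters of $u$ and $v$) and its right graph (one edge joining the last letters of $u$ and $v$) contain no closed path. Put $M=\mathrm{Inv}\langle X\mid u=v\rangle$. Suppose that the presentation is of type (1): - neither of $u,v$ is a subword of the other; - no nonempty prefix of one of $u,v$ is a suffix of the other; - exactly one of $u,v$ overlaps with itself, i.e. has a nonempty proper prefix that is also a suffix of it. Let $w\in X^+$, let $\{r,s\}=\{u,v\}$, and fix an occurrence of $r$ as a subword of $w$. Define inverse word graphs $\Delta_0\subseteq\Delta_1\subseteq\Delta_2\subseteq\cdots$ as follows. $\Delta_0$ is the linear graph of $w$. $\Delta_1$ is obtained from $\Delta_0$ by sewing on a new segment labeled by $s$ from the initial to the terminal vertex of the given occurrence of $r$. For $n\ge 1$, $\Delta_{n+1}$ is obtained from $\Delta_n$ as follows: whenever one of the words $u,v$ labels a path of $\Delta_n$ from a vertex $p$ to a vertex $q$, the other one labels no path of $\Delta_n$ from $p$ to $q$, and $p$ or $q$ is an interior vertex of a segment sewn on at the $n$-th step, sew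 on a new segment from $p$ to $q$ labeled by the other word (all these simultaneously). Let $\Delta=\bigcup_n\Delta_n$. The subgraph of the Schützenberger graph $S\Gamma(w)$ generated by the given occurrence of $r$ is the image of $\Delta$ under the canonical label-preserving morphism to $S\Gamma(w)$ that sends the initial vertex of $\Delta_0$ to $ww^{-1}$. Then $\Delta_n=\Delta_2$ for all $n\ge 2$, that is, the construction stops after at most two iterative steps. Consequently $\Delta$, and the subgraph of $S\Gamma(w)$ generated by the given occurrence of $r$, are finite. -/

import Mathlib

namespace AdianInv

/-! ### Positive presentations, left and right graphs, Adian presentations -/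

/-- A positive presentation `⟨X | R⟩`: a set of pairs of nonempty words over the alphabet `X`. -/
structure PositivePresentation (X : Type*) where
  rels : Set (List X × List X)
  fst_ne : ∀ ρ ∈ rels, ρ.1 ≠ []
  snd_ne : ∀ ρ ∈ rels, ρ.2 ≠ []

/-- `IsWalk e x l y`: in the undirected multigraph with vertex set `X` whose edges are indexed
by `I`, the edge `i` joining the two letters `(e i).1` and `(e i).2`, the list of edges `l` is
traversed by a walk from `x` to `y`. -/
def IsWalk {X I : Type*} (e : I → X × X) : X → List I → X → Prop
  | x, [], y => x = y
  | x, i :: l, y =>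
      ((e i).1 = x ∧ IsWalk e (e i).2 l y) ∨ ((e i).2 = x ∧ IsWalk e (e i).1 l y)

/-- The multigraph has no closed path: no closed walk of positive length that uses pairwise
distinct edges (so there are no loops and no multiple edges either). -/
def CycleFree {X I : Type*} (e : I → X × X) : Prop :=
  ∀ (x : X) (l : List I), l.Nodup → IsWalk e x l x → l = []

namespace PositivePresentation

variable {X : Type*}

/-- The left graph: the relation `(u, v)` joins the first letters of `u` and `v`. -/
def leftGraph (P : PositivePresentation X) (ρ : P.rels) : X × X :=
  (ρ.1.1.head (P.fst_ne _ ρ.2), ρ.1.2.head (P.snd_ne _ ρ.2))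

/-- The right graph: the relation `(u, v)` joins the last letters of `u` and `v`. -/
def rightGraph (P : PositivePresentation X) (ρ : P.rels) : X × X :=
  (ρ.1.1.getLast (P.fst_ne _ ρ.2), ρ.1.2.getLast (P.snd_ne _ ρ.2))

/-- An Adian (cycle free) presentation. -/
def IsAdian (P : PositivePresentation X) : Prop :=
  CycleFree P.leftGraph ∧ CycleFree P.rightGraph

/-- `r` and `s` are the two sides, in either order, of a defining relation. -/
def Rel (P : PositivePresentation X) (r s : List X) : Prop :=
  (r, s) ∈ P.rels ∨ (s, r) ∈ P.rels

/-- The presentation `⟨X | u = v⟩`. -/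
def single (u v : List X) (hu : u ≠ []) (hv : v ≠ []) : PositivePresentation X where
  rels := {(u, v)}
  fst_ne := by rintro _ rfl; exact hu
  snd_ne := by rintro _ rfl; exact hv

end PositivePresentation

/-! ### Overlaps -/

section Overlaps

variable {X : Type*}

/-- A nonempty proper prefix of `u` is also a suffix of `u`. -/
def SelfOverlap (u : List X) : Prop :=
  ∃ t : List X, t ≠ [] ∧ t ≠ u ∧ t <+: u ∧ t <:+ u

/-- A nonempty prefix of one of the two words is a suffix of the other one. -/
def Overlap (u v : List X) : Prop :=
  ∃ t : List X, t ≠ [] ∧ ((t <+: u ∧ t <:+ v) ∨ (t <+: v ∧ t <:+ u))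

/-- The relation `u = v` is of type (1): neither word is a subword of the other, exactly one of
the two words overlaps with itself, and the two words do not overlap with each other. -/
def IsTypeOne (u v : List X) : Prop :=
  ¬ u <:+: v ∧ ¬ v <:+: u ∧ ¬ Overlap u v ∧
    ((SelfOverlap u ∧ ¬ SelfOverlap v) ∨ (SelfOverlap v ∧ ¬ SelfOverlap u))

/-- The word `r` occurs in `w` as a subword, starting after the first `k` letters of `w`. -/
def OccursAt (r w : List X) (k : ℕ) : Prop :=
  r <+: w.drop k

end Overlaps

/-! ### Inverse word graphs -/

/-- A letter of `X ∪ X⁻¹`: `(x, true)` is `x` and `(x, false)` is `x⁻¹`. -/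
abbrev Letter (X : Type*) := X × Bool

/-- The inverse of a letter. -/
def Letter.inv {X : Type*} (a : Letter X) : Letter X := (a.1, !a.2)

/-- An inverse word graph over `X` with vertices in `V`: a directed graph with edges labeled by
`X ∪ X⁻¹` such that `(p, a, q)` is an edge if and only if `(q, a⁻¹, p)` is. -/
@[ext]
structure InvWordGraph (X V : Type*) where
  verts : Set V
  edges : Set (V × Letter X × V)
  src_mem : ∀ p a q, (p, a, q) ∈ edges → p ∈ verts
  tgt_mem : ∀ p a q, (p, a, q) ∈ edges → q ∈ verts
  inv_mem : ∀ p a q, (p, a, q) ∈ edges ↔ (q, a.inv, p) ∈ edges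

namespace InvWordGraph

variable {X V W : Type*}

/-- `G` is a subgraph of `H`. -/
def IsSubgraph (G H : InvWordGraph X V) : Prop :=
  G.verts ⊆ H.verts ∧ G.edges ⊆ H.edges

def IsFinite (G : InvWordGraph X V) : Prop :=
  G.verts.Finite ∧ G.edges.Finite

/-- The positive word `s` labels a path of `G` from `p` to `q`. -/
def Reads (G : InvWordGraph X V) : V → List X → V → Prop
  | p, [], q => p = q ∧ p ∈ G.verts
  | p, x :: s, q => ∃ p', (p, (x, true), p') ∈ G.edges ∧ Reads G p' s q

/-- The path with successive vertices `f 0, f 1, …, f s.length`, labeled by the positive word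
`s`, together with the inverse edges. -/
def ofPath (f : ℕ → V) (s : List X) : InvWordGraph X V where
  verts := {p | ∃ j ≤ s.length, p = f j}
  edges := {e | ∃ j x, s[j]? = some x ∧
    (e = (f j, (x, true), f (j + 1)) ∨ e = (f (j + 1), (x, false), f j))}
  src_mem := by
    rintro p a q ⟨j, x, hx, h⟩
    obtain ⟨hj, -⟩ := List.getElem?_eq_some_iff.1 hx
    rcases h with h | h <;> simp only [Prod.mk.injEq] at h
    · exact ⟨j, by omega, h.1⟩
    · exact ⟨j + 1, by omega, h.1⟩
  tgt_mem := by
    rintro p a q ⟨j, x, hx, h⟩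
    obtain ⟨hj, -⟩ := List.getElem?_eq_some_iff.1 hx
    rcases h with h | h <;> simp only [Prod.mk.injEq] at h
    · exact ⟨j + 1, by omega, h.2.2⟩
    · exact ⟨j, by omega, h.2.2⟩
  inv_mem := by
    rintro p ⟨y, b⟩ q
    constructor
    · rintro ⟨j, x, hx, h⟩
      refine ⟨j, x, hx, ?_⟩
      rcases h with h | h <;> simp only [Prod.mk.injEq] at h <;> simp [Letter.inv, h]
    · rintro ⟨j, x, hx, h⟩
      refine ⟨j, x, hx, ?_⟩
      rcases h with h | h <;> simp only [Prod.mk.injEq, Letter.inv] at h <;> cases b <;> simp_all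

/-- The union of a family of graphs. -/
def iUnion {ι : Sort*} (G : ι → InvWordGraph X V) : InvWordGraph X V where
  verts := ⋃ i, (G i).verts
  edges := ⋃ i, (G i).edges
  src_mem := by
    intro p a q h
    obtain ⟨i, hi⟩ := Set.mem_iUnion.1 h
    exact Set.mem_iUnion.2 ⟨i, (G i).src_mem _ _ _ hi⟩
  tgt_mem := by
    intro p a q h
    obtain ⟨i, hi⟩ := Set.mem_iUnion.1 h
    exact Set.mem_iUnion.2 ⟨i, (G i).tgt_mem _ _ _ hi⟩
  inv_mem := by
    intro p a q
    simp only [Set.mem_iUnion]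
    exact exists_congr fun i => (G i).inv_mem _ _ _

/-- The union of two graphs. -/
def union (G H : InvWordGraph X V) : InvWordGraph X V where
  verts := G.verts ∪ H.verts
  edges := G.edges ∪ H.edges
  src_mem := fun p a q h => h.imp (G.src_mem p a q) (H.src_mem p a q)
  tgt_mem := fun p a q h => h.imp (G.tgt_mem p a q) (H.tgt_mem p a q)
  inv_mem := fun p a q => or_congr (G.inv_mem p a q) (H.inv_mem p a q)

/-- The image of a graph under a map of the vertices (labels are kept). -/
def map (φ : V → W) (G : InvWordGraph X V) : InvWordGraph X W where
  verts := φ '' G.verts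
  edges := (fun e => (φ e.1, e.2.1, φ e.2.2)) '' G.edges
  src_mem := by
    rintro _ _ _ ⟨⟨p, a, q⟩, h, he⟩
    exact ⟨p, G.src_mem _ _ _ h, congrArg Prod.fst he⟩
  tgt_mem := by
    rintro _ _ _ ⟨⟨p, a, q⟩, h, he⟩
    exact ⟨q, G.tgt_mem _ _ _ h, congrArg (fun e => e.2.2) he⟩
  inv_mem := by
    intro p' b q'
    constructor
    · rintro ⟨⟨p, a, q⟩, h, he⟩
      simp only [Prod.mk.injEq] at he
      obtain ⟨rfl, rfl, rfl⟩ := he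
      exact ⟨(q, a.inv, p), (G.inv_mem _ _ _).1 h, rfl⟩
    · rintro ⟨⟨q, a, p⟩, h, he⟩
      simp only [Prod.mk.injEq] at he
      obtain ⟨rfl, rfl, rfl⟩ := he
      exact ⟨(p, b, q), (G.inv_mem _ _ _).2 h, rfl⟩

end InvWordGraph

/-! ### The inverse monoid of a presentation and its Schützenberger graphs -/

section InverseMonoid

variable {X : Type*}

/-- A positive word as an element of `(X ∪ X⁻¹)*`. -/
def posWord (s : List X) : FreeMonoid (Letter X) :=
  FreeMonoid.ofList (s.map fun x => (x, true))

/-- The formal inverse of a word over `X ∪ X⁻¹`. -/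
def invWord (a : FreeMonoid (Letter X)) : FreeMonoid (Letter X) :=
  FreeMonoid.ofList (a.toList.reverse.map Letter.inv)

/-- The generators of the congruence that defines `Inv⟨X | R⟩`: those of the Vagner congruence,
and the pairs in `R`. -/
inductive InvRel (P : PositivePresentation X) :
    FreeMonoid (Letter X) → FreeMonoid (Letter X) → Prop
  | regular (a) : InvRel P (a * invWord a * a) a
  | comm (a b) : InvRel P ((a * invWord a) * (b * invWord b)) ((b * invWord b) * (a * invWord a))
  | rel (u v) : (u, v) ∈ P.rels → InvRel P (posWord u) (posWord v)

/-- The inverse monoid `M = Inv⟨X | R⟩ = (X ∪ X⁻¹)* / τ`. -/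
abbrev InvMonoid (P : PositivePresentation X) := (conGen (InvRel P)).Quotient

/-- The element of `M` represented by a word over `X ∪ X⁻¹`. -/
def cls (P : PositivePresentation X) : FreeMonoid (Letter X) →* InvMonoid P :=
  (conGen (InvRel P)).mk'

/-- The element of `M` represented by a letter. -/
def clsLetter (P : PositivePresentation X) (a : Letter X) : InvMonoid P :=
  cls P (FreeMonoid.of a)

/-- There is an edge from `m` to `m'` in the Cayley graph of `M`. -/
def CayleyStep (P : PositivePresentation X) (m m' : InvMonoid P) : Prop :=
  ∃ a : Letter X, m' = m * clsLetter P a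

/-- The vertices of the strongly connected component of the Cayley graph that contains `m`. -/
def component (P : PositivePresentation X) (m : InvMonoid P) : Set (InvMonoid P) :=
  {m' | Relation.ReflTransGen (CayleyStep P) m m' ∧ Relation.ReflTransGen (CayleyStep P) m' m}

theorem cls_eq {P : PositivePresentation X} {a b : FreeMonoid (Letter X)} (h : InvRel P a b) :
    cls P a = cls P b :=
  (Con.eq _).2 (ConGen.Rel.of _ _ h)

theorem cls_surj (P : PositivePresentation X) (m : InvMonoid P) : ∃ a, cls P a = m :=
  Con.mk'_surjective m

theorem reach_iff (P : PositivePresentation X) (m m' : InvMonoid P) :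
    Relation.ReflTransGen (CayleyStep P) m m' ↔ ∃ t, m' = m * t := by
  constructor
  · intro h
    induction h with
    | refl => exact ⟨1, (mul_one m).symm⟩
    | tail _ h ih =>
      obtain ⟨t, rfl⟩ := ih
      obtain ⟨a, rfl⟩ := h
      exact ⟨t * clsLetter P a, mul_assoc _ _ _⟩
  · rintro ⟨t, rfl⟩
    obtain ⟨a, rfl⟩ := cls_surj P t
    induction a using FreeMonoid.inductionOn' generalizing m with
    | one => rw [map_one, mul_one]
    | of_mul a b ih =>
      rw [map_mul, ← mul_assoc]
      exact Relation.ReflTransGen.head ⟨a, rfl⟩ (ih _)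

theorem invWord_mul (a b : FreeMonoid (Letter X)) :
    invWord (a * b) = invWord b * invWord a := by
  simp [invWord, FreeMonoid.toList_mul]

theorem invWord_invWord (a : FreeMonoid (Letter X)) : invWord (invWord a) = a := by
  have h : (Letter.inv ∘ Letter.inv : Letter X → Letter X) = id := by
    funext a; simp [Letter.inv]
  simp [invWord, h]

theorem cls_mul_inv_of_fix (P : PositivePresentation X) (m a t : FreeMonoid (Letter X))
    (h : cls P m * (cls P a * cls P t) = cls P m) :
    cls P m * cls P a * cls P (invWord a) = cls P m := by
  have reg : ∀ x, cls P x * cls P (invWord x) * cls P x = cls P x := fun x => by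
    simpa using cls_eq (InvRel.regular (P := P) x)
  have com : ∀ x y, cls P x * cls P (invWord x) * (cls P y * cls P (invWord y)) =
      cls P y * cls P (invWord y) * (cls P x * cls P (invWord x)) := fun x y => by
    simpa using cls_eq (InvRel.comm (P := P) x y)
  set c := a * t with hc
  have hcc : cls P c = cls P a * cls P t := map_mul _ _ _
  set f := cls P (invWord m) * cls P m with hf
  have hmf : cls P m * f = cls P m := by rw [hf, ← mul_assoc, reg]
  have hfc : f * cls P c = f := by rw [hf, mul_assoc, hcc, h]
  have hcom : f * (cls P c * cls P (invWord c)) = cls P c * cls P (invWord c) * f := by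
    have := com (invWord m) c
    rwa [invWord_invWord] at this
  have hfcc : f * (cls P c * cls P (invWord c)) = f := by
    have h1 : f = f * (cls P c * cls P (invWord c)) * cls P c := by
      rw [mul_assoc, reg, hfc]
    rw [hcom, mul_assoc, hfc, ← hcom] at h1
    exact h1.symm
  have habs : cls P c * cls P (invWord c) * (cls P a * cls P (invWord a)) =
      cls P c * cls P (invWord c) := by
    rw [com c a, hcc, ← mul_assoc, ← mul_assoc, reg]
  have hfa : f * (cls P a * cls P (invWord a)) = f := by
    conv_lhs => rw [← hfcc, mul_assoc, habs, hfcc]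
  rw [mul_assoc, ← hmf, mul_assoc, hfa]

theorem component_step (P : PositivePresentation X) (m₀ m m' : InvMonoid P) (a : Letter X)
    (hm : m ∈ component P m₀) (hm' : m' ∈ component P m₀) (h : m' = m * clsLetter P a) :
    m = m' * clsLetter P a.inv := by
  obtain ⟨t, ht⟩ := (reach_iff P m' m).1 (hm'.2.trans hm.1)
  obtain ⟨m, rfl⟩ := cls_surj P m
  obtain ⟨t, rfl⟩ := cls_surj P t
  have := cls_mul_inv_of_fix P m (FreeMonoid.of a) t (by
    rw [← mul_assoc]; rw [h] at ht; exact ht.symm)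
  rw [h]
  exact this.symm

/-- The Schützenberger graph `SΓ(w)`: the strongly connected component, in the Cayley graph of
`M`, of the element represented by the positive word `w`. -/
def schutzenbergerGraph (P : PositivePresentation X) (w : List X) :
    InvWordGraph X (InvMonoid P) where
  verts := component P (cls P (posWord w))
  edges := {e | e.1 ∈ component P (cls P (posWord w)) ∧ e.2.2 ∈ component P (cls P (posWord w)) ∧
    e.2.2 = e.1 * clsLetter P e.2.1}
  src_mem := fun _ _ _ h => h.1
  tgt_mem := fun _ _ _ h => h.2.1
  inv_mem := by
    intro p a q
    constructor
    · rintro ⟨hp, hq, h⟩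
      exact ⟨hq, hp, component_step P _ _ _ a hp hq h⟩
    · rintro ⟨hq, hp, h⟩
      refine ⟨hp, hq, ?_⟩
      have := component_step P _ _ _ a.inv hq hp h
      simpa [Letter.inv] using this

end InverseMonoid

/-! ### The iterative construction of the graph generated by an occurrence of an `R`-word -/

/-- Names of vertices: `base j` is the `j`-th vertex of the linear graph of `w`, and
`new p s q j` is the `j`-th vertex (`0 < j < s.length`) of the segment labeled by `s` that is
sewn on from `p` to `q`. A segment labeled by `s` is sewn on from `p` to `q` only when `s` cannot
be read from `p` to `q` yet, hence at most once, so these names are always fresh. -/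
inductive Vert (X : Type*)
  | base : ℕ → Vert X
  | new : Vert X → List X → Vert X → ℕ → Vert X

/-- A segment to be sewn on: its initial vertex, its label, its terminal vertex. -/
structure Segment (X : Type*) where
  src : Vert X
  label : List X
  tgt : Vert X

section Construction

variable {X : Type*}

/-- The `j`-th vertex of a sewn segment. -/
def Segment.vert (σ : Segment X) (j : ℕ) : Vert X :=
  if j = 0 then σ.src
  else if j = σ.label.length then σ.tgt
  else Vert.new σ.src σ.label σ.tgt j

/-- The linear graph of the segment, attached at its two end vertices. -/
def Segment.graph (σ : Segment X) : InvWordGraph X (Vert X) :=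
  InvWordGraph.ofPath σ.vert σ.label

/-- `p` is an interior vertex of the segment. -/
def Segment.IsInterior (σ : Segment X) (p : Vert X) : Prop :=
  ∃ j, 0 < j ∧ j < σ.label.length ∧ p = σ.vert j

/-- The linear graph of the positive word `w`. -/
def linearGraph (w : List X) : InvWordGraph X (Vert X) :=
  InvWordGraph.ofPath Vert.base w

/-- Sewing a set of segments onto a graph. -/
def sew (G : InvWordGraph X (Vert X)) (S : Set (Segment X)) : InvWordGraph X (Vert X) :=
  G.union (InvWordGraph.iUnion fun σ : S => σ.1.graph)

/-- The segments to be sewn on to `G` in the next step, when `S` is the set of those that were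
sewn on in the last step. They are the segments `σ`, with label `s`, for which some `R`-word `r`
with `r = s` a relation labels an unsaturated segment of `G` with the same end vertices, one of
which is an interior vertex of a segment in `S`. -/
def nextSegments (P : PositivePresentation X) (G : InvWordGraph X (Vert X))
    (S : Set (Segment X)) : Set (Segment X) :=
  {σ | (∃ r, P.Rel r σ.label ∧ G.Reads σ.src r σ.tgt ∧ ¬ G.Reads σ.src σ.label σ.tgt) ∧
    ∃ ρ ∈ S, ρ.IsInterior σ.src ∨ ρ.IsInterior σ.tgt}

/-- The `n`-th step of the construction that starts from the occurrence of `r` in `w` after the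
first `k` letters, with the relation `r = s`: the graph `Δₙ`, and the set of segments that were
sewn on in the `n`-th step. -/
def step (P : PositivePresentation X) (w r s : List X) (k : ℕ) :
    ℕ → InvWordGraph X (Vert X) × Set (Segment X)
  | 0 => (linearGraph w, ∅)
  | 1 =>
      let S : Set (Segment X) := {⟨Vert.base k, s, Vert.base (k + r.length)⟩}
      (sew (linearGraph w) S, S)
  | n + 2 =>
      let S := nextSegments P (step P w r s k (n + 1)).1 (step P w r s k (n + 1)).2
      (sew (step P w r s k (n + 1)).1 S, S)

/-- The graph `Δₙ`. -/
def delta (P : PositivePresentation X) (w r s : List X) (k n : ℕ) : InvWordGraph X (Vert X) :=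
  (step P w r s k n).1

/-- The limit `Δ` of the increasing sequence `Δ₀ ⊆ Δ₁ ⊆ Δ₂ ⊆ …`. -/
def deltaLimit (P : PositivePresentation X) (w r s : List X) (k : ℕ) : InvWordGraph X (Vert X) :=
  InvWordGraph.iUnion (delta P w r s k)

/-- The canonical map to `SΓ(w)`, which preserves labels and sends the initial vertex of the
linear graph of `w` to `w w⁻¹`. -/
def toMonoid (P : PositivePresentation X) (w : List X) : Vert X → InvMonoid P
  | Vert.base j => cls P (posWord w * invWord (posWord w) * posWord (w.take j))
  | Vert.new p s _ j => toMonoid P w p * cls P (posWord (s.take j))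

/-- Auxiliary: the canonical map is a morphism from `G` to `SΓ(w)`. -/
def IsMor (P : PositivePresentation X) (w : List X) (G : InvWordGraph X (Vert X)) : Prop :=
  (∀ p ∈ G.verts, toMonoid P w p ∈ (schutzenbergerGraph P w).verts) ∧
  ∀ p a q, (p, a, q) ∈ G.edges →
    (toMonoid P w p, a, toMonoid P w q) ∈ (schutzenbergerGraph P w).edges

theorem posWord_append (s t : List X) : posWord (s ++ t) = posWord s * posWord t := by
  simp [posWord]

theorem cls_rel {P : PositivePresentation X} {r s : List X} (h : P.Rel r s) :
    cls P (posWord r) = cls P (posWord s) := by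
  rcases h with h | h
  · exact cls_eq (InvRel.rel _ _ h)
  · exact (cls_eq (InvRel.rel _ _ h)).symm

theorem mem_component_of_between (P : PositivePresentation X) (m₀ m m' t t' : InvMonoid P)
    (hm : m ∈ component P m₀) (hm' : m * t * t' ∈ component P m₀) (h : m' = m * t) :
    m' ∈ component P m₀ := by
  subst h
  exact ⟨hm.1.trans ((reach_iff P _ _).2 ⟨t, rfl⟩), ((reach_iff P _ _).2 ⟨t', rfl⟩).trans hm'.2⟩

/-- A path whose vertices are mapped to `m, m x₁, m x₁ x₂, …`, with both ends in the component. -/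
theorem isMor_ofPath (P : PositivePresentation X) (w s : List X) (f : ℕ → Vert X)
    (m : InvMonoid P)
    (hf : ∀ j ≤ s.length, toMonoid P w (f j) = m * cls P (posWord (s.take j)))
    (hm : m ∈ component P (cls P (posWord w)))
    (hms : m * cls P (posWord s) ∈ component P (cls P (posWord w))) :
    IsMor P w (InvWordGraph.ofPath f s) := by
  have hv : ∀ j ≤ s.length, toMonoid P w (f j) ∈ component P (cls P (posWord w)) := by
    intro j hj
    refine mem_component_of_between P _ m _ _ (cls P (posWord (s.drop j))) hm ?_ (hf j hj)
    rw [mul_assoc, ← map_mul, ← posWord_append, List.take_append_drop]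
    exact hms
  have he : ∀ j x, s[j]? = some x →
      (toMonoid P w (f j), (x, true), toMonoid P w (f (j + 1))) ∈
        (schutzenbergerGraph P w).edges := by
    intro j x hx
    obtain ⟨hj, -⟩ := List.getElem?_eq_some_iff.1 hx
    refine ⟨hv j hj.le, hv (j + 1) hj, ?_⟩
    simp only
    rw [hf j hj.le, hf (j + 1) hj, mul_assoc, List.take_add_one, hx, posWord_append, map_mul]
    rfl
  constructor
  · rintro p ⟨j, hj, rfl⟩
    exact hv j hj
  · rintro p a q ⟨j, x, hx, h⟩
    rcases h with h | h <;> simp only [Prod.mk.injEq] at h <;> obtain ⟨rfl, rfl, rfl⟩ := h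
    · exact he j x hx
    · exact ((schutzenbergerGraph P w).inv_mem _ _ _).1 (he j x hx)

theorem isMor_linearGraph (P : PositivePresentation X) (w : List X) :
    IsMor P w (linearGraph w) := by
  have hw : cls P (posWord w) * cls P (invWord (posWord w)) * cls P (posWord w) =
      cls P (posWord w) := by
    simpa using cls_eq (InvRel.regular (P := P) (posWord w))
  refine isMor_ofPath P w w _ (cls P (posWord w * invWord (posWord w))) ?_ ⟨?_, ?_⟩ ?_
  · intro j _
    simp [toMonoid]
  · exact (reach_iff P _ _).2 ⟨cls P (invWord (posWord w)), map_mul _ _ _⟩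
  · exact (reach_iff P _ _).2 ⟨cls P (posWord w), by rw [map_mul, hw]⟩
  · rw [map_mul, hw]
    exact ⟨Relation.ReflTransGen.refl, Relation.ReflTransGen.refl⟩

theorem isMor_segment (P : PositivePresentation X) (w : List X) (σ : Segment X)
    (hp : toMonoid P w σ.src ∈ component P (cls P (posWord w)))
    (hq : toMonoid P w σ.tgt ∈ component P (cls P (posWord w)))
    (h : toMonoid P w σ.tgt = toMonoid P w σ.src * cls P (posWord σ.label)) :
    IsMor P w σ.graph := by
  refine isMor_ofPath P w σ.label _ (toMonoid P w σ.src) ?_ hp (h ▸ hq)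
  intro j hj
  unfold Segment.vert
  split_ifs with h0 h1
  · subst h0
    simp [posWord]
  · subst h1
    rw [h, List.take_length]
  · rfl

theorem reads_toMonoid (P : PositivePresentation X) (w : List X) (G : InvWordGraph X (Vert X))
    (hG : IsMor P w G) (s : List X) : ∀ p q, G.Reads p s q →
      toMonoid P w p ∈ component P (cls P (posWord w)) ∧
      toMonoid P w q ∈ component P (cls P (posWord w)) ∧
      toMonoid P w q = toMonoid P w p * cls P (posWord s) := by
  induction s with
  | nil =>
    rintro p q ⟨rfl, hp⟩
    exact ⟨hG.1 _ hp, hG.1 _ hp, by simp [posWord]⟩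
  | cons x s ih =>
    rintro p q ⟨p', he, hr⟩
    obtain ⟨_, h2, h3⟩ := ih p' q hr
    obtain ⟨h4, _, h6⟩ := hG.2 _ _ _ he
    refine ⟨h4, h2, ?_⟩
    simp only at h6
    rw [h3, h6, mul_assoc, ← List.singleton_append, posWord_append, map_mul]
    rfl

theorem isMor_sew (P : PositivePresentation X) (w : List X) (G : InvWordGraph X (Vert X))
    (S : Set (Segment X)) (hG : IsMor P w G) (hS : ∀ σ ∈ S, IsMor P w σ.graph) :
    IsMor P w (sew G S) := by
  constructor
  · rintro p (h | h)
    · exact hG.1 p h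
    · obtain ⟨σ, hσ⟩ := Set.mem_iUnion.1 h
      exact (hS _ σ.2).1 p hσ
  · rintro p a q (h | h)
    · exact hG.2 p a q h
    · obtain ⟨σ, hσ⟩ := Set.mem_iUnion.1 h
      exact (hS _ σ.2).2 p a q hσ

theorem isMor_delta (P : PositivePresentation X) (w r s : List X) (k : ℕ) (hrs : P.Rel r s)
    (hk : OccursAt r w k) (n : ℕ) : IsMor P w (delta P w r s k n) := by
  have hr : r ≠ [] := by
    rcases hrs with h | h
    · exact P.fst_ne _ h
    · exact P.snd_ne _ h
  unfold delta
  induction n with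
  | zero => exact isMor_linearGraph P w
  | succ n ih =>
    cases n with
    | zero =>
      refine isMor_sew P w _ _ (isMor_linearGraph P w) ?_
      rintro σ rfl
      have hlen : k + r.length ≤ w.length := by
        have h1 := hk.length_le
        have h2 := List.length_pos_of_ne_nil hr
        rw [List.length_drop] at h1
        omega
      have hmor := isMor_linearGraph P w
      refine isMor_segment P w _ (hmor.1 _ ⟨k, by omega, rfl⟩) (hmor.1 _ ⟨_, hlen, rfl⟩) ?_
      have ht : w.take (k + r.length) = w.take k ++ r := by
        rw [List.take_add, (List.prefix_iff_eq_take.1 hk).symm]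
      simp only [toMonoid]
      rw [ht, posWord_append, ← cls_rel hrs]
      simp only [map_mul, mul_assoc]
    | succ n =>
      refine isMor_sew P w _ _ ih ?_
      rintro σ ⟨⟨t, hrel, hread, -⟩, -⟩
      obtain ⟨h1, h2, h3⟩ := reads_toMonoid P w _ ih _ _ _ hread
      exact isMor_segment P w σ h1 h2 (by rw [h3, cls_rel hrel])

/-- The subgraph of `SΓ(w)` generated by the occurrence of the `R`-word `r` in `w` after the
first `k` letters: the image of `Δ` under the canonical map. -/
def generatedSubgraph (P : PositivePresentation X) (w r s : List X) (k : ℕ) (hrs : P.Rel r s)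
    (hk : OccursAt r w k) :
    {G : InvWordGraph X (InvMonoid P) // G.IsSubgraph (schutzenbergerGraph P w)} :=
  ⟨(deltaLimit P w r s k).map (toMonoid P w), by
    constructor
    · rintro _ ⟨p, hp, rfl⟩
      obtain ⟨n, hn⟩ := Set.mem_iUnion.1 hp
      exact (isMor_delta P w r s k hrs hk n).1 p hn
    · rintro _ ⟨⟨p, a, q⟩, he, rfl⟩
      obtain ⟨n, hn⟩ := Set.mem_iUnion.1 he
      exact (isMor_delta P w r s k hrs hk n).2 p a q hn⟩

end Construction

end AdianInv

namespace AdianInv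

/-! ### Combinatorics of words: what a type (1) pair allows. -/

section Words

variable {X : Type*}

/-! An interior vertex of a newly sewn segment meets no positive edges except the two of its own
segment. Let the segments sewn on at some step all be labeled by one relation word `c`, let `d` be
the other word, and let `t`, one of `c` and `d`, label a path starting inside such a segment. The
path is forced to follow the segment up to its end, so `t` and a nonempty proper suffix `e` of `c`
are prefix-comparable. The choice `t = d` would give either an occurrence of `d` inside `c` or an
overlap of `c` with `d`; hence `t = c`, and `e` is a prefix of `c`, so `c` overlaps with itself.
Paths ending inside a segment are symmetric (`IsFresh.isTypeOne_eq_of_reads`).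

Therefore a step with label `c` is followed by one whose labels are all `d`, and anything is sewn on
there only if `c` overlaps with itself. The first step has label `s`. A nonempty second step makes
`s` self-overlapping and has label `r`; a nonempty third step would make `r` self-overlapping too,
against type (1). Freshness survives the second step because vertex names record labels and `r ≠ s`.
Finiteness holds because only finitely many segments with a given label can join vertices of a
finite graph. -/

theorem IsTypeOne.symm {u v : List X} (h : IsTypeOne u v) : IsTypeOne v u :=
  ⟨h.2.1, h.1, fun ⟨t, ht, h'⟩ => h.2.2.1 ⟨t, ht, h'.symm⟩, h.2.2.2.symm⟩

theorem IsTypeOne.ne {u v : List X} (h : IsTypeOne u v) : u ≠ v := by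
  rintro rfl
  exact h.1 List.infix_rfl

theorem IsTypeOne.not_selfOverlap_right {u v : List X} (h : IsTypeOne u v) (hu : SelfOverlap u) :
    ¬ SelfOverlap v := by
  rcases h.2.2.2 with h | h
  · exact h.2
  · exact absurd hu h.2

theorem PositivePresentation.rel_single {u v : List X} {hu : u ≠ []} {hv : v ≠ []}
    {r s : List X} :
    (PositivePresentation.single u v hu hv).Rel r s ↔ (r = u ∧ s = v) ∨ (s = u ∧ r = v) := by
  simp [PositivePresentation.Rel, PositivePresentation.single]

/-- If one of the words `c`, `d` of type (1) and a nonempty proper suffix of `c` are prefixes of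
a common word, then it is `c` that does so, and `c` overlaps with itself. -/
theorem IsTypeOne.eq_of_suffix {c d t e : List X} (h : IsTypeOne d c) (ht : t = c ∨ t = d)
    (he : e ≠ []) (hec : e ≠ c) (hsuf : e <:+ c) (H : t <+: e ∨ e <+: t) :
    t = c ∧ SelfOverlap c := by
  rcases ht with rfl | rfl
  · refine ⟨rfl, e, he, hec, ?_, hsuf⟩
    rcases H with H | H
    -- Here `c` would be a prefix of its own suffix `e`, so the lengths force `e = c`.
    · exact absurd (hsuf.eq_of_length_le H.length_le) hec
    · exact H
  · rcases H with H | H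
    · exact absurd (H.isInfix.trans hsuf.isInfix) h.1
    · exact absurd ⟨e, he, Or.inl ⟨H, hsuf⟩⟩ h.2.2.1

/-- If one of the words `c`, `d` of type (1) and a nonempty proper prefix of `c` are suffixes of
a common word, then it is `c` that does so, and `c` overlaps with itself. -/
theorem IsTypeOne.eq_of_prefix {c d t e : List X} (h : IsTypeOne d c) (ht : t = c ∨ t = d)
    (he : e ≠ []) (hec : e ≠ c) (hpre : e <+: c) (H : t <:+ e ∨ e <:+ t) :
    t = c ∧ SelfOverlap c := by
  rcases ht with rfl | rfl
  · refine ⟨rfl, e, he, hec, hpre, ?_⟩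
    rcases H with H | H
    · exact absurd (hpre.eq_of_length_le H.length_le) hec
    · exact H
  · rcases H with H | H
    · exact absurd (H.isInfix.trans hpre.isInfix) h.1
    · exact absurd ⟨e, he, Or.inr ⟨hpre, H⟩⟩ h.2.2.1

end Words

/-! ### Positive paths and finiteness of inverse word graphs. -/

namespace InvWordGraph

variable {X V W : Type*}

/-- `Reads` peels letters off the front; this form peels off the last one, for following a path
backwards from its end. -/
theorem reads_concat {G : InvWordGraph X V} {s : List X} {x : X} {p q : V} :
    G.Reads p (s ++ [x]) q ↔ ∃ p', G.Reads p s p' ∧ (p', (x, true), q) ∈ G.edges := by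
  induction s generalizing p with
  | nil =>
    constructor
    · rintro ⟨q', he, rfl, -⟩
      exact ⟨p, ⟨rfl, G.src_mem _ _ _ he⟩, he⟩
    · rintro ⟨_, ⟨rfl, -⟩, he⟩
      exact ⟨q, he, rfl, G.tgt_mem _ _ _ he⟩
  | cons y s ih =>
    constructor
    · rintro ⟨p₁, he, hr⟩
      obtain ⟨p', h1, h2⟩ := ih.1 hr
      exact ⟨p', ⟨p₁, he, h1⟩, h2⟩
    · rintro ⟨p', ⟨p₁, he, h1⟩, h2⟩
      exact ⟨p₁, he, ih.2 ⟨p', h1, h2⟩⟩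

theorem Reads.mem_verts {G : InvWordGraph X V} {s : List X} {p q : V} (h : G.Reads p s q) :
    p ∈ G.verts ∧ q ∈ G.verts := by
  induction s generalizing p with
  | nil => exact ⟨h.2, h.1 ▸ h.2⟩
  | cons x s ih =>
    obtain ⟨p', he, hr⟩ := h
    exact ⟨G.src_mem _ _ _ he, (ih hr).2⟩

theorem isFinite_ofPath (f : ℕ → V) (s : List X) : (ofPath f s).IsFinite := by
  constructor
  · refine ((Set.finite_Iic s.length).image f).subset ?_
    rintro _ ⟨j, hj, rfl⟩
    exact ⟨j, hj, rfl⟩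
  · refine (((Set.finite_Iio s.length).prod s.finite_toSet).image
      (fun a => (f a.1, (a.2, true), f (a.1 + 1)))).union
      (((Set.finite_Iio s.length).prod s.finite_toSet).image
      (fun a => (f (a.1 + 1), (a.2, false), f a.1))) |>.subset ?_
    rintro e ⟨j, x, hx, h⟩
    have hm : (j, x) ∈ (Set.Iio s.length) ×ˢ {x | x ∈ s} :=
      ⟨(List.getElem?_eq_some_iff.1 hx).1, List.mem_of_getElem? hx⟩
    exact h.imp (fun h => ⟨_, hm, h.symm⟩) (fun h => ⟨_, hm, h.symm⟩)

theorem IsFinite.union {G H : InvWordGraph X V} (hG : G.IsFinite) (hH : H.IsFinite) :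
    (G.union H).IsFinite :=
  ⟨hG.1.union hH.1, hG.2.union hH.2⟩

theorem IsFinite.iUnion {ι : Type*} [Finite ι] {G : ι → InvWordGraph X V}
    (hG : ∀ i, (G i).IsFinite) : (InvWordGraph.iUnion G).IsFinite :=
  ⟨Set.finite_iUnion fun i => (hG i).1, Set.finite_iUnion fun i => (hG i).2⟩

theorem IsFinite.map {G : InvWordGraph X V} (hG : G.IsFinite) (φ : V → W) :
    (G.map φ).IsFinite :=
  ⟨hG.1.image _, hG.2.image _⟩

end InvWordGraph

/-! ### Fresh segments and the paths through their interior vertices. -/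

section Construction

variable {X : Type*}

theorem Segment.vert_of_lt (σ : Segment X) {j : ℕ} (hj : 0 < j) (hjl : j < σ.label.length) :
    σ.vert j = Vert.new σ.src σ.label σ.tgt j := by
  rw [Segment.vert, if_neg hj.ne', if_neg hjl.ne]

/-- The segments in `S` have their ends in `G`, and their interior vertices are new. -/
structure IsFresh (G : InvWordGraph X (Vert X)) (S : Set (Segment X)) : Prop where
  src_mem : ∀ σ ∈ S, σ.src ∈ G.verts
  tgt_mem : ∀ σ ∈ S, σ.tgt ∈ G.verts
  new_notMem : ∀ σ ∈ S, ∀ j, Vert.new σ.src σ.label σ.tgt j ∉ G.verts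

namespace IsFresh

variable {G : InvWordGraph X (Vert X)} {S : Set (Segment X)}

/-- The name of an interior vertex records its whole segment and its position, and the ends of
segments lie in `G`, where no such name occurs. So distinct segments never share interior vertices.
-/
theorem eq_of_vert_eq (h : IsFresh G S) {σ ρ : Segment X} (hσ : σ ∈ S) (hρ : ρ ∈ S) {i j : ℕ}
    (hj : 0 < j) (hjl : j < σ.label.length) (he : σ.vert j = ρ.vert i) : ρ = σ ∧ i = j := by
  rw [σ.vert_of_lt hj hjl] at he
  unfold Segment.vert at he
  split_ifs at he
  · exact absurd (he ▸ h.src_mem ρ hρ) (h.new_notMem σ hσ j)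
  · exact absurd (he ▸ h.tgt_mem ρ hρ) (h.new_notMem σ hσ j)
  · obtain ⟨p, l, q⟩ := σ
    obtain ⟨p', l', q'⟩ := ρ
    simp_all

theorem vert_notMem (h : IsFresh G S) {σ : Segment X} (hσ : σ ∈ S) {j : ℕ}
    (hj : 0 < j) (hjl : j < σ.label.length) : σ.vert j ∉ G.verts := by
  rw [σ.vert_of_lt hj hjl]
  exact h.new_notMem σ hσ j

theorem edge_from (h : IsFresh G S) {σ : Segment X} (hσ : σ ∈ S) {j : ℕ} (hj : 0 < j)
    (hjl : j < σ.label.length) {x : X} {q : Vert X}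
    (he : (σ.vert j, (x, true), q) ∈ (sew G S).edges) :
    σ.label[j]? = some x ∧ q = σ.vert (j + 1) := by
  rcases he with he | he
  · exact absurd (G.src_mem _ _ _ he) (h.vert_notMem hσ hj hjl)
  -- Inverse edges of a segment carry the sign `false`, so only its forward edges remain.
  · obtain ⟨ρ, i, y, hy, he | he⟩ := Set.mem_iUnion.1 he <;>
      simp only [Prod.mk.injEq, Bool.true_eq_false, and_false, false_and] at he
    obtain ⟨h1, ⟨rfl, -⟩, rfl⟩ := he
    obtain ⟨rfl, rfl⟩ := h.eq_of_vert_eq hσ ρ.2 hj hjl h1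
    exact ⟨hy, rfl⟩

theorem edge_to (h : IsFresh G S) {σ : Segment X} (hσ : σ ∈ S) {j : ℕ}
    (hjl : j + 1 < σ.label.length) {x : X} {p : Vert X}
    (he : (p, (x, true), σ.vert (j + 1)) ∈ (sew G S).edges) :
    σ.label[j]? = some x ∧ p = σ.vert j := by
  rcases he with he | he
  · exact absurd (G.tgt_mem _ _ _ he) (h.vert_notMem hσ j.succ_pos hjl)
  · obtain ⟨ρ, i, y, hy, he | he⟩ := Set.mem_iUnion.1 he <;>
      simp only [Prod.mk.injEq, Bool.true_eq_false, and_false, false_and] at he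
    obtain ⟨rfl, ⟨rfl, -⟩, h1⟩ := he
    obtain ⟨rfl, hi⟩ := h.eq_of_vert_eq hσ ρ.2 j.succ_pos hjl h1
    obtain rfl : i = j := by omega
    exact ⟨hy, rfl⟩

/-- The path has no choice until the segment ends. After that nothing is known about it, hence the
two alternatives. -/
theorem reads_from (h : IsFresh G S) {σ : Segment X} (hσ : σ ∈ S) {t : List X} {q : Vert X}
    {j : ℕ} (hj : 0 < j) (hjl : j < σ.label.length) (hr : (sew G S).Reads (σ.vert j) t q) :
    t <+: σ.label.drop j ∨ σ.label.drop j <+: t := by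
  induction t generalizing j with
  | nil => exact Or.inl List.nil_prefix
  | cons x t ih =>
    obtain ⟨p', he, hr⟩ := hr
    obtain ⟨hx, rfl⟩ := h.edge_from hσ hj hjl he
    obtain ⟨_, rfl⟩ := List.getElem?_eq_some_iff.1 hx
    rw [List.drop_eq_getElem_cons hjl]
    by_cases hl : j + 1 < σ.label.length
    · simpa only [List.cons_prefix_cons, true_and] using ih j.succ_pos hl hr
    -- The letter just read was the last one of the segment.
    · rw [List.drop_eq_nil_of_le (not_lt.1 hl)]
      exact Or.inr (by simp)

/-- Mirror image of `reads_from`, by induction from the last letter. The case `j = 0` may be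
included: the part of the segment before its initial vertex is the empty word. -/
theorem reads_to (h : IsFresh G S) {σ : Segment X} (hσ : σ ∈ S) {t : List X} {p : Vert X}
    {j : ℕ} (hjl : j < σ.label.length) (hr : (sew G S).Reads p t (σ.vert j)) :
    t <:+ σ.label.take j ∨ σ.label.take j <:+ t := by
  induction t using List.reverseRecOn generalizing j with
  | nil => exact Or.inl List.nil_suffix
  | append_singleton t x ih =>
    cases j with
    | zero => exact Or.inr (by simp)
    | succ j =>
      obtain ⟨p', hr, he⟩ := InvWordGraph.reads_concat.1 hr
      obtain ⟨hx, rfl⟩ := h.edge_to hσ hjl he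
      rw [List.take_add_one, hx, Option.toList_some]
      have aux : ∀ {a b : List X}, a <:+ b → a ++ [x] <:+ b ++ [x] := by
        rintro a _ ⟨e, rfl⟩
        exact ⟨e, (List.append_assoc e a [x]).symm⟩
      exact (ih (by omega) hr).imp aux aux

/-- The central step: forced paths turn the graph condition into prefix or suffix comparability, to
which `IsTypeOne.eq_of_suffix` and `IsTypeOne.eq_of_prefix` apply. -/
theorem isTypeOne_eq_of_reads (h : IsFresh G S) {c d t : List X} (hcd : IsTypeOne d c)
    (ht : t = c ∨ t = d) (hS : ∀ σ ∈ S, σ.label = c) {p q : Vert X}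
    (hr : (sew G S).Reads p t q) (hpq : ∃ ρ ∈ S, ρ.IsInterior p ∨ ρ.IsInterior q) :
    t = c ∧ SelfOverlap c := by
  obtain ⟨σ, hσ, ⟨j, hj, hjl, rfl⟩ | ⟨j, hj, hjl, rfl⟩⟩ := hpq
  · have H := h.reads_from hσ hj hjl hr
    rw [hS σ hσ] at H hjl
    refine hcd.eq_of_suffix ht ?_ ?_ (List.drop_suffix j c) H
    -- Interiority is used twice: `j < c.length` makes the suffix nonempty, and `0 < j` makes it
    -- proper.
    · exact List.ne_nil_of_length_pos (by rw [List.length_drop]; omega)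
    · exact fun h0 => by have := congrArg List.length h0; rw [List.length_drop] at this; omega
  · have H := h.reads_to hσ hjl hr
    rw [hS σ hσ] at H hjl
    refine hcd.eq_of_prefix ht ?_ ?_ (List.take_prefix j c) H
    · exact List.ne_nil_of_length_pos (by rw [List.length_take]; omega)
    · exact fun h0 => by have := congrArg List.length h0; rw [List.length_take] at this; omega

end IsFresh

/-! ### Stabilization and finiteness of the construction. -/

theorem nextSegments_empty (P : PositivePresentation X) (G : InvWordGraph X (Vert X)) :
    nextSegments P G ∅ = ∅ := by
  ext; simp [nextSegments]

theorem sew_empty (G : InvWordGraph X (Vert X)) : sew G ∅ = G := by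
  ext <;> simp [sew, InvWordGraph.union, InvWordGraph.iUnion]

theorem InvWordGraph.IsFinite.sew {G : InvWordGraph X (Vert X)} (hG : G.IsFinite)
    {S : Set (Segment X)} (hS : S.Finite) : (sew G S).IsFinite :=
  have := hS.to_subtype
  hG.union (.iUnion fun _ => isFinite_ofPath _ _)

/-- With the label fixed, a segment is determined by its pair of end vertices. -/
theorem finite_of_labels {G : InvWordGraph X (Vert X)} (hG : G.IsFinite) {S : Set (Segment X)}
    {c : List X} (hS : ∀ σ ∈ S, σ.src ∈ G.verts ∧ σ.label = c ∧ σ.tgt ∈ G.verts) : S.Finite := by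
  refine ((hG.1.prod hG.1).image fun a => (⟨a.1, c, a.2⟩ : Segment X)).subset fun σ hσ => ?_
  obtain ⟨h1, rfl, h2⟩ := hS σ hσ
  exact ⟨(σ.src, σ.tgt), ⟨h1, h2⟩, rfl⟩

/-- New segments must touch the interior of one sewn on in the last step, so an empty step is
followed only by empty steps. The index starts at `m + 1` because step `0` also records the empty
set, yet step `1` does sew. -/
theorem step_of_empty {P : PositivePresentation X} {w r s : List X} {k m : ℕ}
    (h : (step P w r s k (m + 1)).2 = ∅) (n : ℕ) :
    step P w r s k (m + 1 + n) = step P w r s k (m + 1) := by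
  induction n with
  | zero => rfl
  | succ n ih =>
    -- The index is put in the form `_ + 2` so that the recursive clause of `step` unfolds
    -- definitionally.
    have h2 : step P w r s k (m + n + 2) =
        (sew (step P w r s k (m + 1 + n)).1
          (nextSegments P (step P w r s k (m + 1 + n)).1 (step P w r s k (m + 1 + n)).2),
          nextSegments P (step P w r s k (m + 1 + n)).1 (step P w r s k (m + 1 + n)).2) := by
      rw [show m + 1 + n = m + n + 1 by omega]; rfl
    rw [show m + 1 + (n + 1) = m + n + 2 by omega, h2, ih, h, nextSegments_empty, sew_empty]
    exact Prod.ext rfl h.symm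

/-- If the steps of the construction sew on nothing after the second one, then the construction
stops there. -/
theorem delta_eq_of_empty {P : PositivePresentation X} {w r s : List X} {k : ℕ}
    (h : (step P w r s k 3).2 = ∅) {n : ℕ} (hn : 2 ≤ n) :
    delta P w r s k n = delta P w r s k 2 := by
  have h3 : delta P w r s k 3 = delta P w r s k 2 := by
    change sew (step P w r s k 2).1 (step P w r s k 3).2 = _
    rw [h, sew_empty]
    rfl
  obtain rfl | hn := hn.eq_or_lt
  · rfl
  · obtain ⟨m, rfl⟩ := Nat.exists_eq_add_of_le hn
    exact (congrArg Prod.fst (step_of_empty (m := 2) h m)).trans h3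

/-- Stabilization at `N` reduces the infinite union to the graphs with index at most `N`. -/
theorem isFinite_deltaLimit {P : PositivePresentation X} {w r s : List X} {k N : ℕ}
    (hN : ∀ n, N ≤ n → delta P w r s k n = delta P w r s k N)
    (hfin : ∀ n, n ≤ N → (delta P w r s k n).IsFinite) : (deltaLimit P w r s k).IsFinite := by
  have h : deltaLimit P w r s k =
      InvWordGraph.iUnion fun i : Fin (N + 1) => delta P w r s k i := by
    have key : ∀ n, ∃ i : Fin (N + 1), delta P w r s k n = delta P w r s k i := fun n => by
      rcases le_total N n with hn | hn
      · exact ⟨Fin.last N, hN n hn⟩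
      · exact ⟨⟨n, by omega⟩, rfl⟩
    ext e
    · simp only [deltaLimit, InvWordGraph.iUnion, Set.mem_iUnion]
      refine ⟨fun ⟨n, hn⟩ => ?_, fun ⟨i, hi⟩ => ⟨i, hi⟩⟩
      obtain ⟨i, hi⟩ := key n
      exact ⟨i, by rwa [← hi]⟩
    · simp only [deltaLimit, InvWordGraph.iUnion, Set.mem_iUnion]
      refine ⟨fun ⟨n, hn⟩ => ?_, fun ⟨i, hi⟩ => ⟨i, hi⟩⟩
      obtain ⟨i, hi⟩ := key n
      exact ⟨i, by rwa [← hi]⟩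
  rw [h]
  exact .iUnion fun i => hfin i (by omega)

/-! ### Alternation of labels for a type (1) relation. -/

section TypeOne

variable {u v : List X} {hu : u ≠ []} {hv : v ≠ []}

theorem isTypeOne_of_rel (h : IsTypeOne u v) {r s : List X}
    (hrs : (PositivePresentation.single u v hu hv).Rel r s) : IsTypeOne r s := by
  rcases PositivePresentation.rel_single.1 hrs with ⟨rfl, rfl⟩ | ⟨rfl, rfl⟩
  · exact h
  · exact h.symm

/-- Only a segment whose label overlaps with itself gives rise to new segments, and they are
labeled by the other word. -/
theorem label_of_mem_nextSegments {r s : List X} (h : IsTypeOne u v)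
    (hrs : (PositivePresentation.single u v hu hv).Rel r s)
    {G : InvWordGraph X (Vert X)} {S : Set (Segment X)} (hGS : IsFresh G S)
    (hS : ∀ σ ∈ S, σ.label = s) {σ : Segment X}
    (hσ : σ ∈ nextSegments (PositivePresentation.single u v hu hv) (sew G S) S) :
    σ.label = r ∧ SelfOverlap s := by
  obtain ⟨⟨t, hrel, hread, -⟩, hint⟩ := hσ
  have hts := isTypeOne_of_rel h hrs
  have key : (t = s ∧ σ.label = r) ∨ (t = r ∧ σ.label = s) := by
    rw [PositivePresentation.rel_single] at hrs hrel
    grind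
  -- The word read is the label `s` of the last segments, so the word to be sewn on is the other
  -- one.
  obtain ⟨rfl, hself⟩ := hGS.isTypeOne_eq_of_reads hts (key.imp And.left And.left) hS hread hint
  exact ⟨(key.resolve_right fun h => hts.ne h.1.symm).2, hself⟩

end TypeOne

theorem isFresh_first {w r s : List X} {k : ℕ} (hk : k + r.length ≤ w.length) :
    IsFresh (linearGraph w) {⟨Vert.base k, s, Vert.base (k + r.length)⟩} where
  src_mem := by rintro _ rfl; exact ⟨k, by omega, rfl⟩
  tgt_mem := by rintro _ rfl; exact ⟨_, hk, rfl⟩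
  new_notMem := by rintro _ _ _ ⟨_, -, h⟩; cases h

/-- New segments with another label than those sewn on before are fresh. -/
theorem isFresh_nextSegments {P : PositivePresentation X} {w : List X} {S : Set (Segment X)}
    {r s : List X} (hrs : r ≠ s) (hend : IsFresh (linearGraph w) S) (hS : ∀ σ ∈ S, σ.label = s)
    (hT : ∀ σ ∈ nextSegments P (sew (linearGraph w) S) S, σ.label = r) :
    IsFresh (sew (linearGraph w) S) (nextSegments P (sew (linearGraph w) S) S) where
  src_mem := by rintro σ ⟨⟨_, -, h, -⟩, -⟩; exact h.mem_verts.1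
  tgt_mem := by rintro σ ⟨⟨_, -, h, -⟩, -⟩; exact h.mem_verts.2
  new_notMem := by
    -- Vertices of the linear graph, including the ends of segments in `S`, are `base` vertices; all
    -- others carry the label `s` in their name, while the names at issue carry `r`.
    rintro σ hσ j (⟨_, -, h⟩ | h)
    · cases h
    · obtain ⟨ρ, i, -, h⟩ := Set.mem_iUnion.1 h
      unfold Segment.vert at h
      split_ifs at h
      · obtain ⟨_, -, h'⟩ := hend.src_mem ρ ρ.2
        rw [h'] at h
        cases h
      · obtain ⟨_, -, h'⟩ := hend.tgt_mem ρ ρ.2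
        rw [h'] at h
        cases h
      · injection h with _ h
        exact hrs ((hT σ hσ).symm.trans (h.trans (hS ρ ρ.2)))

end Construction

end AdianInv

/-! ### The main theorem. -/

theorem lemmaL3 {X : Type*} (u v : List X) (hu : u ≠ []) (hv : v ≠ [])
    (hA : (AdianInv.PositivePresentation.single u v hu hv).IsAdian)
    (h1 : AdianInv.IsTypeOne u v)
    (w : List X) (hw : w ≠ [])
    (r s : List X) (hrs : (AdianInv.PositivePresentation.single u v hu hv).Rel r s)
    (k : ℕ) (hk : AdianInv.OccursAt r w k) :
    (∀ n, 2 ≤ n →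
      AdianInv.delta (AdianInv.PositivePresentation.single u v hu hv) w r s k n =
        AdianInv.delta (AdianInv.PositivePresentation.single u v hu hv) w r s k 2) ∧
    (AdianInv.deltaLimit (AdianInv.PositivePresentation.single u v hu hv) w r s k).IsFinite ∧
    (AdianInv.generatedSubgraph (AdianInv.PositivePresentation.single u v hu hv) w r s k
      hrs hk).1.IsFinite := by
  set P := AdianInv.PositivePresentation.single u v hu hv with hP
  have hk' : k + r.length ≤ w.length := by
    -- Needed because `w.drop k` is empty for `k` beyond the end of `w`, where only the empty word
    -- would occur.
    have h2 : 0 < r.length := by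
      rcases hrs with h | h
      · exact List.length_pos_of_ne_nil (P.fst_ne _ h)
      · exact List.length_pos_of_ne_nil (P.snd_ne _ h)
    have h3 := hk.length_le
    rw [List.length_drop] at h3
    omega
  have hrs1 := AdianInv.isTypeOne_of_rel h1 hrs
  set S : Set (AdianInv.Segment X) :=
    {⟨AdianInv.Vert.base k, s, AdianInv.Vert.base (k + r.length)⟩} with hS
  have hSs : ∀ σ ∈ S, σ.label = s := by rintro _ rfl; rfl
  have hS1 : AdianInv.IsFresh (AdianInv.linearGraph w) S := AdianInv.isFresh_first hk'
  have hT : ∀ σ ∈ (AdianInv.step P w r s k 2).2, σ.label = r ∧ AdianInv.SelfOverlap s :=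
    fun σ hσ => AdianInv.label_of_mem_nextSegments h1 hrs hS1 hSs hσ
  have hS2 : AdianInv.IsFresh (AdianInv.delta P w r s k 1) (AdianInv.step P w r s k 2).2 :=
    AdianInv.isFresh_nextSegments hrs1.ne hS1 hSs fun σ hσ => (hT σ hσ).1
  have h3 : (AdianInv.step P w r s k 3).2 = ∅ := by
    refine Set.eq_empty_of_forall_notMem fun σ hσ => ?_
    -- The roles of `r` and `s` are exchanged: the last segments now have label `r`, so a third-step
    -- segment makes `r` overlap with itself.
    have hr := (AdianInv.label_of_mem_nextSegments h1 hrs.symm hS2 (fun σ hσ => (hT σ hσ).1) hσ).2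
    -- It also touches some second-step segment `ρ`, whose existence makes `s` overlap with itself.
    obtain ⟨-, ρ, hρ, -⟩ := hσ
    exact hrs1.not_selfOverlap_right hr (hT ρ hρ).2
  have hstab : ∀ n, 2 ≤ n → AdianInv.delta P w r s k n = AdianInv.delta P w r s k 2 :=
    fun n hn => AdianInv.delta_eq_of_empty h3 hn
  have hfin0 : (AdianInv.delta P w r s k 0).IsFinite :=
    AdianInv.InvWordGraph.isFinite_ofPath _ _
  have hfin1 : (AdianInv.delta P w r s k 1).IsFinite := hfin0.sew (Set.finite_singleton _)
  have hfin2 : (AdianInv.delta P w r s k 2).IsFinite :=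
    hfin1.sew (AdianInv.finite_of_labels hfin1 fun σ hσ =>
      ⟨hS2.src_mem σ hσ, (hT σ hσ).1, hS2.tgt_mem σ hσ⟩)
  have hlim : (AdianInv.deltaLimit P w r s k).IsFinite :=
    AdianInv.isFinite_deltaLimit hstab fun n hn => by
      interval_cases n
      exacts [hfin0, hfin1, hfin2]
  exact ⟨hstab, hlim, hlim.map _⟩
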